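/- By a tree we mean a finite, nonempty, undirected tree; a rooted tree is a tree with a distinguished vertex (its root), and its automorphisms are the graph automorphisms that fix the root. A group $G$ is \emph{representable} on a (rooted) tree if there is a nontrivial homomorphism from $G$ to its automorphism group. There is a polynomial time algorithm (a Turing machine, with trees given by their adjacency matrices) that, given as input a tree $T$, outputs a rooted tree $T'$ such that for every group $G$, $G$ is representable on $T$ if and only if $G$ is representable on the rooted tree $T'$. Moreover, up to relabelling the vertices, $T'$ is either 1. $T$ itself, rooted at a vertex $\alpha$ that is fixed by every automorphism of $T$; or 2. the tree obtained from $T$ by replacing an edge $\{\alpha,\beta\}$, which every automorphism of $T$ maps to itself, by a path $\alpha - \gamma - \beta$ through a new vertex $\gamma$, rooted at $\gamma$. In both cases the automorphism group is unchanged: there is a group isomorphism $\mathrm{Aut}(T) \cong \mathrm{Aut}(T')$ that is compatible with the actions on the vertices of $T$. -/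

import Mathlib

namespace TreeRooting

/-- A finite (undirected, nonempty) tree, with vertices labelled `0, …, n - 1`. -/
structure FinTree where
  n : ℕ
  graph : SimpleGraph (Fin n)
  isTree : graph.IsTree

/-- A finite tree with a distinguished vertex, its root. -/
structure RootedFinTree extends FinTree where
  root : Fin n

/-- The automorphisms of a graph that fix a given vertex `r`, i.e. the automorphism group of the
graph rooted at `r`. -/
def rootedAut {V : Type*} (X : SimpleGraph V) (r : V) : Subgroup (X ≃g X) where
  carrier := {g | g r = r}
  one_mem' := rfl
  mul_mem' := by
    intro a b ha hb
    change a (b r) = r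
    rw [show b r = r from hb, show a r = r from ha]
  inv_mem' := by
    intro a ha
    change a.symm r = r
    rw [RelIso.symm_apply_eq, show a r = r from ha]

/-- `G` is representable on the graph `X`: there is a nontrivial homomorphism `G → Aut X`. -/
def Representable (G : Type*) [Group G] {V : Type*} (X : SimpleGraph V) : Prop :=
  ∃ ρ : G →* (X ≃g X), ∃ g : G, ρ g ≠ 1

/-- `G` is representable on the graph `X` rooted at `r`: there is a nontrivial homomorphism from
`G` to the group of root-preserving automorphisms. -/
def RootedRepresentable (G : Type*) [Group G] {V : Type*} (X : SimpleGraph V) (r : V) : Prop :=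
  ∃ ρ : G →* rootedAut X r, ∃ g : G, ρ g ≠ 1

/-- The alphabet of inputs and outputs: two bits and an end marker. -/
inductive Symb where
  | zero
  | one
  | sep
  deriving DecidableEq

instance : Fintype Symb where
  elems := {Symb.zero, Symb.one, Symb.sep}
  complete := by intro x; cases x <;> simp

open Classical in
/-- Row `i` of the adjacency matrix, followed by an end marker. -/
noncomputable def encodeRow {n : ℕ} (X : SimpleGraph (Fin n)) (i : Fin n) : List Symb :=
  List.ofFn (fun j : Fin n => if X.Adj i j then Symb.one else Symb.zero) ++ [Symb.sep]

/-- The adjacency matrix, written row by row. -/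
noncomputable def encodeGraph {n : ℕ} (X : SimpleGraph (Fin n)) : List Symb :=
  (List.finRange n).flatMap (encodeRow X)

/-- A tree is given by its adjacency matrix; the length of this word is `n ^ 2 + n`. -/
noncomputable def FinTree.encode (T : FinTree) : List Symb :=
  encodeGraph T.graph

/-- A rooted tree is given by the label of its root in unary, an end marker, and its adjacency
matrix. -/
noncomputable def RootedFinTree.encode (T : RootedFinTree) : List Symb :=
  List.replicate (T.root : ℕ) Symb.one ++ Symb.sep :: encodeGraph T.graph

/-- `T'` is the tree `T` (identified along `ι`), rooted at a vertex `α` that every automorphism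
of `T` fixes. -/
def IsRootingAtFixedVertex (T : FinTree) (T' : RootedFinTree) (ι : Fin T.n ↪ Fin T'.n) : Prop :=
  ∃ α : Fin T.n,
    (∀ g : T.graph ≃g T.graph, g α = α) ∧
    Function.Surjective ι ∧
    (∀ u v, T'.graph.Adj (ι u) (ι v) ↔ T.graph.Adj u v) ∧
    T'.root = ι α

/-- `T'` arises from `T` (embedded along `ι`) by replacing an edge `αβ` that every automorphism
of `T` maps to itself by a path `α — γ — β` through one new vertex `γ`, the root of `T'`. -/
def IsRootingAtFixedEdge (T : FinTree) (T' : RootedFinTree) (ι : Fin T.n ↪ Fin T'.n) : Prop :=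
  ∃ α β : Fin T.n,
    T.graph.Adj α β ∧
    (∀ g : T.graph ≃g T.graph, s(g α, g β) = s(α, β)) ∧
    Set.range ι = {T'.root}ᶜ ∧
    (∀ u v, T'.graph.Adj (ι u) (ι v) ↔ T.graph.Adj u v ∧ s(u, v) ≠ s(α, β)) ∧
    (∀ v, T'.graph.Adj T'.root (ι v) ↔ v = α ∨ v = β)

/-- The automorphism groups of `T` and of the rooted tree `T'` are the same: they are isomorphic,
compatibly with their actions on the vertices of `T` (embedded in those of `T'` along `ι`). -/
def SameAutomorphisms (T : FinTree) (T' : RootedFinTree) (ι : Fin T.n ↪ Fin T'.n) : Prop :=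
  ∃ Φ : (T.graph ≃g T.graph) ≃* rootedAut T'.graph T'.root,
    ∀ (g : T.graph ≃g T.graph) (v : Fin T.n),
      (Φ g : T'.graph ≃g T'.graph) (ι v) = ι (g v)

end TreeRooting

/-! Remove all leaves of a finite tree, and repeat while something remains. The last nonempty vertex
set, the center, is invariant under automorphisms because every stage is. Each stage is convex,
since an inner vertex of a path has two neighbours on that path (`PathConvex.twoNbrs`). A nonempty
convex set induces a subtree, so it has a vertex with fewer than two neighbours inside it and the
process strictly shrinks (`PathConvex.not_subset_twoNbrs`). In a convex set where no vertex has two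
neighbours, any two vertices are adjacent, and three are impossible; hence the center is a vertex or
an edge (`PathConvex.eq_singleton_or_pair`).

A center that is a vertex becomes the root, and fixing it is no restriction. A center that is an
edge is subdivided: automorphisms extend by fixing the new vertex, and conversely an automorphism
fixing the new vertex preserves its two neighbours, hence also the deleted edge
(`exists_extendAut_eq`). Representability depends only on the automorphism group.

For the complexity, a machine with five stacks holds the matrix and the current set as words and
rereads the matrix once per stage. There are at most `n` rounds of `O(n ^ 2)` steps, and the output
takes `O(n ^ 2)` more. `Runs` composes the time-bounded loops into `runs_rooting`. -/

namespace TreeRooting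

open Turing

/-! ### The Turing machine -/

/-- The stacks of the machine: the matrix (input and output) with the part of it already read,
the current vertex set with the part of it already read, and the next vertex set. -/
inductive Stk where
  | mat
  | matRead
  | set
  | setRead
  | next
  deriving DecidableEq

instance : Fintype Stk where
  elems := {.mat, .matRead, .set, .setRead, .next}
  complete := by intro x; cases x <;> simp

/-- The labels of the machine. A parameter `c : Fin 3` is a counter that saturates at `2`. -/
inductive Lab where
  | init
  | rewind
  | row (c : Fin 3) (found : Bool)
  | rowBit (c : Fin 3) (found m : Bool)
  | rowEnd (c : Fin 3) (found : Bool)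
  | rowRewind (found : Bool)
  | clearSet
  | moveNext
  | clearNext
  | scan (c : Fin 3)
  | single
  | skip
  | unary
  | edge
  | edgeFetch
  | edgeRow (s : Bool)
  | edgeBit (s x : Bool)
  | edgeRewind
  | lastRow
  | done

instance : Finite Lab := by
  let f : Lab → Fin 20 × Fin 3 × Bool × Bool := fun
    | .init => (0, 0, false, false)
    | .rewind => (1, 0, false, false)
    | .row c b => (2, c, b, false)
    | .rowBit c b m => (3, c, b, m)
    | .rowEnd c b => (4, c, b, false)
    | .rowRewind b => (5, 0, b, false)
    | .clearSet => (6, 0, false, false)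
    | .moveNext => (7, 0, false, false)
    | .clearNext => (8, 0, false, false)
    | .scan c => (9, c, false, false)
    | .single => (10, 0, false, false)
    | .skip => (11, 0, false, false)
    | .unary => (12, 0, false, false)
    | .edge => (13, 0, false, false)
    | .edgeFetch => (14, 0, false, false)
    | .edgeRow s => (15, 0, s, false)
    | .edgeBit s x => (16, 0, s, x)
    | .edgeRewind => (17, 0, false, false)
    | .lastRow => (18, 0, false, false)
    | .done => (19, 0, false, false)
  refine Finite.of_injective f fun x y h => ?_
  cases x <;> cases y <;> simp_all [f]

noncomputable instance : Fintype Lab := Fintype.ofFinite Lab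

/-- The symbol of a bit. -/
def sym (b : Bool) : Symb := if b then .one else .zero

/-- The bit of a symbol. -/
def Symb.bit (s : Symb) : Bool := decide (s = .one)

@[simp] theorem bit_sym (b : Bool) : (sym b).bit = b := by cases b <;> rfl

@[simp] theorem sym_ne_sep (b : Bool) : sym b ≠ .sep := by cases b <;> simp [sym]

/-- Counting, saturated at `2`. -/
def bump (c : Fin 3) (b : Bool) : Fin 3 := if b then (if c = 0 then 1 else 2) else c

/-- The number of true values of `p` on `l`, starting from `c` and saturated at `2`. -/
def satCount {α : Type*} (p : α → Bool) (c : Fin 3) (l : List α) : Fin 3 :=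
  l.foldl (fun c j => bump c (p j)) c

@[simp] theorem satCount_cons {α : Type*} (p : α → Bool) (c : Fin 3) (x : α) (l : List α) :
    satCount p c (x :: l) = satCount p (bump c (p x)) l := rfl

theorem satCount_eq_two_iff {α : Type*} (p : α → Bool) (c : Fin 3) (l : List α) :
    satCount p c l = 2 ↔ 2 ≤ (c : ℕ) + l.countP p := by
  induction l generalizing c with
  | nil => simp only [satCount, List.foldl_nil, List.countP_nil]; omega
  | cons x l ih =>
    rw [satCount_cons, ih, List.countP_cons]
    cases p x
    · simp [bump]
    · have h : ∀ c : Fin 3, (bump c true : ℕ) = min 2 ((c : ℕ) + 1) := by decide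
      rw [h, if_pos rfl]
      omega

abbrev MStmt := TM2.Stmt (fun _ : Stk => Symb) Lab (Option Symb)

abbrev MCfg := TM2.Cfg (fun _ : Stk => Symb) Lab (Option Symb)

/-- Pop from a stack into the register. -/
abbrev popTo (k : Stk) (q : MStmt) : MStmt := .pop k (fun _ x => x) q

/-- Pop from a stack, ignoring the symbol. -/
abbrev drop (k : Stk) (q : MStmt) : MStmt := .pop k (fun s _ => s) q

/-- Push the register. -/
abbrev pushReg (k : Stk) (q : MStmt) : MStmt := .push k (fun s => s.getD .zero) q

/-- Push a constant. -/
abbrev pushSymb (k : Stk) (x : Symb) (q : MStmt) : MStmt := .push k (fun _ => x) q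

/-- Jump to a fixed label. -/
abbrev jump (l : Lab) : MStmt := .goto fun _ => l

/-- Branch on whether the register is empty. -/
abbrev ifNone (p q : MStmt) : MStmt := .branch Option.isNone p q

/-- The label to go to when the current set, with `c` elements, is the last nonempty one. -/
def output (c : Fin 3) : Lab := if c = 2 then .edge else .single

/-- The program. First the current set is filled with all vertices. In each round, every row is
compared with the current set, to see whether the vertex of that row has two neighbours in the
current set; these vertices form the next set. If the next set is empty, the output is prepared
from the current set. -/
def program : Lab → MStmt
  -- Only the first row is read here: its length is `n`, so it yields the full set as a word of `n`
  -- ones.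
  | .init => popTo .mat <| .branch (fun s => s = some .sep)
      (pushReg .matRead <| jump .rewind)
      (pushReg .matRead <| pushSymb .set .one <| jump .init)
  | .rewind => popTo .matRead <| ifNone (jump (.row 0 false)) (pushReg .mat <| jump .rewind)
  | .row c b => popTo .mat <| .goto fun
      | none => if b then .clearSet else .clearNext
      | some .sep => .rowEnd c b
      | some x => .rowBit c b x.bit
  | .rowBit c b m => pushSymb .matRead (sym m) <| popTo .set <| pushReg .setRead <|
      .goto fun s => .row (bump c (m && (s.getD .zero).bit)) b
  | .rowEnd c b => pushSymb .matRead .sep <| pushSymb .next (sym (c = 2)) <|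
      jump (.rowRewind (b || c = 2))
  | .rowRewind b => popTo .setRead <|
      ifNone (jump (.row 0 b)) (pushReg .set <| jump (.rowRewind b))
  | .clearSet => popTo .set <| ifNone (jump .moveNext) (jump .clearSet)
  | .moveNext => popTo .next <| ifNone (jump .rewind) (pushReg .set <| jump .moveNext)
  | .clearNext => popTo .next <| ifNone (jump (.scan 0)) (jump .clearNext)
  | .scan c => popTo .set <| ifNone (jump (output c))
      (pushReg .setRead <| pushReg .next <| .goto fun s => .scan (bump c (s.getD .zero).bit))
  | .single => popTo .matRead <| ifNone (pushSymb .mat .sep <| jump .skip)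
      (pushReg .mat <| jump .single)
  -- The set lies reversed on the stack, so the entries below its only `one` belong to the vertices
  -- before the root, and their number is the label of the root. The copy on `next` is popped in
  -- parallel only to leave that stack empty.
  | .skip => popTo .setRead <| drop .next <|
      .branch (fun s => s = some .one) (jump .unary) (jump .skip)
  | .unary => popTo .setRead <| drop .next <|
      ifNone (jump .done) (pushSymb .mat .one <| jump .unary)
  -- The new matrix is written from its last symbol to its first. The marker pushed here ends an old
  -- row, or, when the old matrix is exhausted, the row of the new vertex.
  | .edge => popTo .matRead <| pushSymb .mat .sep <| ifNone (jump .lastRow) (jump .edgeFetch)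
  | .edgeFetch => popTo .next <| .goto fun s => .edgeRow (s.getD .zero).bit
  | .edgeRow s => popTo .setRead <| .branch Option.isNone
      (pushSymb .mat (sym s) <| jump .edgeRewind)
      (pushReg .set <| .goto fun x => .edgeBit s (x.getD .zero).bit)
  | .edgeBit s x => popTo .matRead <|
      .push .mat (fun m => sym ((m.getD .zero).bit && !(s && x))) <| jump (.edgeRow s)
  | .edgeRewind => popTo .set <| ifNone (jump .edge) (pushReg .setRead <| jump .edgeRewind)
  | .lastRow => popTo .setRead <| ifNone
      (pushSymb .mat .zero <| pushSymb .mat .sep <| jump .done)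
      (pushReg .mat <| jump .lastRow)
  -- A halting configuration must have the initial register.
  | .done => .load (fun _ => none) .halt

/-- The machine. -/
noncomputable def machine : FinTM2 where
  K := Stk
  k₀ := .mat
  k₁ := .mat
  Γ _ := Symb
  Λ := Lab
  main := .init
  σ := Option Symb
  initialState := none
  m := program

/-! ### Stack contents and time-bounded runs -/

/-- The contents of the five stacks. -/
def contents (m m' a a' b : List Symb) : Stk → List Symb
  | .mat => m
  | .matRead => m'
  | .set => a
  | .setRead => a'
  | .next => b

section
variable (m m' a a' b x : List Symb)

@[simp] theorem contents_mat : contents m m' a a' b .mat = m := rfl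
@[simp] theorem contents_matRead : contents m m' a a' b .matRead = m' := rfl
@[simp] theorem contents_set : contents m m' a a' b .set = a := rfl
@[simp] theorem contents_setRead : contents m m' a a' b .setRead = a' := rfl
@[simp] theorem contents_next : contents m m' a a' b .next = b := rfl

@[simp] theorem update_mat :
    Function.update (contents m m' a a' b) .mat x = contents x m' a a' b := by
  ext k : 1; cases k <;> rfl
@[simp] theorem update_matRead :
    Function.update (contents m m' a a' b) .matRead x = contents m x a a' b := by
  ext k : 1; cases k <;> rfl
@[simp] theorem update_set :
    Function.update (contents m m' a a' b) .set x = contents m m' x a' b := by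
  ext k : 1; cases k <;> rfl
@[simp] theorem update_setRead :
    Function.update (contents m m' a a' b) .setRead x = contents m m' a x b := by
  ext k : 1; cases k <;> rfl
@[simp] theorem update_next :
    Function.update (contents m m' a a' b) .next x = contents m m' a a' x := by
  ext k : 1; cases k <;> rfl
end

/-- From label `l` with stacks `S`, whatever the register, the machine comes to label `l'` with
stacks `S'` within `t` steps. -/
def Runs (t : ℕ) (l : Lab) (S : Stk → List Symb) (l' : Lab) (S' : Stk → List Symb) : Prop :=
  ∀ v, ∃ v', ∃ k ≤ t, (flip bind (TM2.step program))^[k] (some (⟨some l, v, S⟩ : MCfg)) =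
    some ⟨some l', v', S'⟩

theorem Runs.refl (l : Lab) (S : Stk → List Symb) : Runs 0 l S l S :=
  fun v => ⟨v, 0, le_rfl, rfl⟩

theorem Runs.trans {t₁ t₂ t : ℕ} {l₁ l₂ l₃ : Lab} {S₁ S₂ S₃ : Stk → List Symb}
    (h₁ : Runs t₁ l₁ S₁ l₂ S₂) (h₂ : Runs t₂ l₂ S₂ l₃ S₃) (ht : t₁ + t₂ ≤ t) :
    Runs t l₁ S₁ l₃ S₃ := by
  intro v
  obtain ⟨v₂, k₁, hk₁, e₁⟩ := h₁ v
  obtain ⟨v₃, k₂, hk₂, e₂⟩ := h₂ v₂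
  exact ⟨v₃, k₂ + k₁, by omega, by rw [Function.iterate_add_apply, e₁, e₂]⟩

theorem Runs.mono {t t' : ℕ} {l l' : Lab} {S S' : Stk → List Symb} (h : Runs t l S l' S')
    (ht : t ≤ t') : Runs t' l S l' S' :=
  h.trans (Runs.refl _ _) (by omega)

/-- A single step. -/
theorem Runs.step {l l' : Lab} {S S' : Stk → List Symb}
    (h : ∀ v, ∃ v', TM2.stepAux (program l) v S = ⟨some l', v', S'⟩) : Runs 1 l S l' S' := by
  intro v
  obtain ⟨v', e⟩ := h v
  exact ⟨v', 1, le_rfl, by simp [flip, e]⟩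

/-! ### Loops that move or clear a stack -/

theorem runs_init (l r m' a : List Symb) (hl : ∀ x ∈ l, x ≠ .sep) :
    Runs (l.length + 1) .init (contents (l ++ .sep :: r) m' a [] []) .rewind
      (contents r (.sep :: l.reverse ++ m') (List.replicate l.length .one ++ a) [] []) := by
  induction l generalizing m' a with
  | nil => exact .step fun v => ⟨some .sep, by simp [program]⟩
  | cons x l ih =>
    have hx := hl x List.mem_cons_self
    have h := ih (x :: m') (.one :: a) fun y hy => hl y (List.mem_cons_of_mem _ hy)
    rw [List.length_cons, List.replicate_succ', List.reverse_cons]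
    refine .trans (t₁ := 1) (.step fun v => ⟨some x, ?_⟩) (by simpa using h) (by omega)
    simp [program, hx]

theorem runs_rewind (l m a : List Symb) :
    Runs (l.length + 1) .rewind (contents m l a [] []) (.row 0 false)
      (contents (l.reverse ++ m) [] a [] []) := by
  induction l generalizing m with
  | nil => exact .step fun v => ⟨none, by simp [program]⟩
  | cons x l ih =>
    refine .trans (t₁ := 1) (.step fun v => ⟨some x, ?_⟩) (by simpa using ih (x :: m))
      (by simp; omega)
    simp [program]

theorem runs_rowRewind (f : Bool) (l m m' a b : List Symb) :
    Runs (l.length + 1) (.rowRewind f) (contents m m' a l b) (.row 0 f)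
      (contents m m' (l.reverse ++ a) [] b) := by
  induction l generalizing a with
  | nil => exact .step fun v => ⟨none, by simp [program]⟩
  | cons x l ih =>
    refine .trans (t₁ := 1) (.step fun v => ⟨some x, ?_⟩) (by simpa using ih (x :: a))
      (by simp; omega)
    simp [program]

theorem runs_clearSet (l m m' b : List Symb) :
    Runs (l.length + 1) .clearSet (contents m m' l [] b) .moveNext (contents m m' [] [] b) := by
  induction l with
  | nil => exact .step fun v => ⟨none, by simp [program]⟩
  | cons x l ih =>
    exact .trans (t₁ := 1) (.step fun v => ⟨some x, by simp [program]⟩) ih (by simp; omega)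

theorem runs_moveNext (l m m' a : List Symb) :
    Runs (l.length + 1) .moveNext (contents m m' a [] l) .rewind
      (contents m m' (l.reverse ++ a) [] []) := by
  induction l generalizing a with
  | nil => exact .step fun v => ⟨none, by simp [program]⟩
  | cons x l ih =>
    refine .trans (t₁ := 1) (.step fun v => ⟨some x, ?_⟩) (by simpa using ih (x :: a))
      (by simp; omega)
    simp [program]

theorem runs_clearNext (l m m' a : List Symb) :
    Runs (l.length + 1) .clearNext (contents m m' a [] l) (.scan 0) (contents m m' a [] []) := by
  induction l with
  | nil => exact .step fun v => ⟨none, by simp [program]⟩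
  | cons x l ih =>
    exact .trans (t₁ := 1) (.step fun v => ⟨some x, by simp [program]⟩) ih (by simp; omega)

theorem runs_single (l m a' b : List Symb) :
    Runs (l.length + 1) .single (contents m l [] a' b) .skip
      (contents (.sep :: (l.reverse ++ m)) [] [] a' b) := by
  induction l generalizing m with
  | nil => exact .step fun v => ⟨none, by simp [program]⟩
  | cons x l ih =>
    refine .trans (t₁ := 1) (.step fun v => ⟨some x, ?_⟩) (by simpa using ih (x :: m))
      (by simp; omega)
    simp [program]

theorem runs_skip (k : ℕ) (l m : List Symb) :
    Runs (k + 1) .skip (contents m [] [] (List.replicate k .zero ++ .one :: l)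
        (List.replicate k .zero ++ .one :: l)) .unary (contents m [] [] l l) := by
  induction k with
  | zero => exact .step fun v => ⟨some .one, by simp [program]⟩
  | succ k ih =>
    exact .trans (t₁ := 1)
      (.step fun v => ⟨some .zero, by simp [program, List.replicate_succ]⟩) ih (by omega)

theorem runs_unary (l m : List Symb) :
    Runs (l.length + 1) .unary (contents m [] [] l l) .done
      (contents (List.replicate l.length .one ++ m) [] [] [] []) := by
  induction l generalizing m with
  | nil => exact .step fun v => ⟨none, by simp [program]⟩
  | cons x l ih =>
    rw [List.length_cons, List.replicate_succ']
    refine .trans (t₁ := 1) (.step fun v => ⟨some x, ?_⟩) (by simpa using ih (.one :: m))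
      (by omega)
    simp [program]

theorem runs_edgeRewind (l m m' a' b : List Symb) :
    Runs (l.length + 1) .edgeRewind (contents m m' l a' b) .edge
      (contents m m' [] (l.reverse ++ a') b) := by
  induction l generalizing a' with
  | nil => exact .step fun v => ⟨none, by simp [program]⟩
  | cons x l ih =>
    refine .trans (t₁ := 1) (.step fun v => ⟨some x, ?_⟩) (by simpa using ih (x :: a'))
      (by simp; omega)
    simp [program]

theorem runs_lastRow (l m : List Symb) :
    Runs (l.length + 1) .lastRow (contents m [] [] l []) .done
      (contents (.sep :: .zero :: (l.reverse ++ m)) [] [] [] []) := by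
  induction l generalizing m with
  | nil => exact .step fun v => ⟨none, by simp [program]⟩
  | cons x l ih =>
    refine .trans (t₁ := 1) (.step fun v => ⟨some x, ?_⟩) (by simpa using ih (x :: m))
      (by simp; omega)
    simp [program]

/-! ### Rounds of leaf removal on words of bits -/

section
variable {α : Type*}

/-- The word of a family of bits. -/
def word (l : List α) (p : α → Bool) : List Symb := l.map fun j => sym (p j)

@[simp] theorem word_nil (p : α → Bool) : word [] p = [] := rfl

@[simp] theorem word_cons (x : α) (l : List α) (p : α → Bool) :
    word (x :: l) p = sym (p x) :: word l p := rfl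

@[simp] theorem word_append (l l' : List α) (p : α → Bool) :
    word (l ++ l') p = word l p ++ word l' p := List.map_append

@[simp] theorem length_word (l : List α) (p : α → Bool) : (word l p).length = l.length :=
  List.length_map _

@[simp] theorem word_reverse (l : List α) (p : α → Bool) :
    word l.reverse p = (word l p).reverse := List.map_reverse

/-- The word of a matrix of bits, with an end marker after each row. -/
def matrixWord (rows cols : List α) (M : α → α → Bool) : List Symb :=
  rows.flatMap fun i => word cols (M i) ++ [Symb.sep]

/-- Each column costs two steps, one popping the matrix and one popping the set. The words `p` and
`q` have equal length, so both run out at the end marker. -/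
theorem runs_row_bits (f : Bool) (c : Fin 3) (l : List α) (p q : α → Bool)
    (m m' a' b : List Symb) :
    Runs (2 * l.length) (.row c f) (contents (word l p ++ m) m' (word l q) a' b)
      (.row (satCount (fun j => p j && q j) c l) f)
      (contents m ((word l p).reverse ++ m') [] ((word l q).reverse ++ a') b) := by
  induction l generalizing c m' a' with
  | nil => exact .refl _ _
  | cons x l ih =>
    have h₁ : Runs 1 (.row c f) (contents (word (x :: l) p ++ m) m' (word (x :: l) q) a' b)
        (.rowBit c f (p x)) (contents (word l p ++ m) m' (word (x :: l) q) a' b) :=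
      .step fun v => ⟨some (sym (p x)), by cases hp : p x <;> simp [program, hp, sym, Symb.bit]⟩
    have h₂ : Runs 1 (.rowBit c f (p x)) (contents (word l p ++ m) m' (word (x :: l) q) a' b)
        (.row (bump c (p x && q x)) f)
        (contents (word l p ++ m) (sym (p x) :: m') (word l q) (sym (q x) :: a') b) :=
      .step fun v => ⟨some (sym (q x)), by simp [program]⟩
    refine (h₁.trans h₂ le_rfl).trans (t₂ := 2 * l.length) ?_ (by simp; omega)
    simpa using ih (bump c (p x && q x)) (sym (p x) :: m') (sym (q x) :: a')

/-- Two of the entries of `p` at `l` are true in `q`. -/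
def twice (l : List α) (p q : α → Bool) : Bool := decide (2 ≤ l.countP fun j => p j && q j)

theorem runs_row (f : Bool) (l : List α) (p q : α → Bool) (m m' b : List Symb) :
    Runs (3 * l.length + 3) (.row 0 f)
      (contents (word l p ++ [Symb.sep] ++ m) m' (word l q) [] b) (.row 0 (f || twice l p q))
      (contents m ((word l p ++ [Symb.sep]).reverse ++ m') (word l q) [] (sym (twice l p q) :: b)) := by
  have h₁ := runs_row_bits f 0 l p q (.sep :: m) m' [] b
  set c := satCount (fun j => p j && q j) 0 l with hc
  have hc' : decide (c = 2) = twice l p q := by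
    rw [twice, hc, decide_eq_decide, satCount_eq_two_iff]; simp
  -- The set is now reversed on `setRead`; `rowRewind` restores it for the next row.
  have h₂ : Runs 1 (.row c f)
      (contents (.sep :: m) ((word l p).reverse ++ m') [] ((word l q).reverse ++ []) b)
      (.rowEnd c f) (contents m ((word l p).reverse ++ m') [] (word l q).reverse b) :=
    .step fun v => ⟨some .sep, by simp [program]⟩
  have h₃ : Runs 1 (.rowEnd c f) (contents m ((word l p).reverse ++ m') [] (word l q).reverse b)
      (.rowRewind (f || twice l p q)) (contents m (.sep :: ((word l p).reverse ++ m')) []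
        (word l q).reverse (sym (twice l p q) :: b)) :=
    .step fun v => ⟨v, by simp [program, hc']⟩
  have h₄ := runs_rowRewind (f || twice l p q) (word l q).reverse m
    (.sep :: ((word l p).reverse ++ m')) [] (sym (twice l p q) :: b)
  have := ((h₁.trans h₂ le_rfl).trans h₃ le_rfl).trans h₄
    (t := 3 * l.length + 3) (by simp; omega)
  simpa using this

theorem runs_rows (f : Bool) (rows cols : List α) (M : α → α → Bool) (q : α → Bool)
    (m' b : List Symb) :
    Runs (rows.length * (3 * cols.length + 3)) (.row 0 f)
      (contents (matrixWord rows cols M) m' (word cols q) [] b)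
      (.row 0 (f || rows.any fun i => twice cols (M i) q))
      (contents [] ((matrixWord rows cols M).reverse ++ m') (word cols q) []
        ((word rows fun i => twice cols (M i) q).reverse ++ b)) := by
  induction rows generalizing f m' b with
  | nil => simpa [matrixWord] using Runs.refl _ _
  | cons i rows ih =>
    have h₁ := runs_row f cols (M i) q (matrixWord rows cols M) m' b
    have h₂ := ih (f || twice cols (M i) q) ((word cols (M i) ++ [Symb.sep]).reverse ++ m')
      (sym (twice cols (M i) q) :: b)
    have := h₁.trans h₂ (t := (i :: rows).length * (3 * cols.length + 3))
      (by simp only [List.length_cons]; ring_nf; omega)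
    simpa [matrixWord, Bool.or_assoc] using this

theorem length_matrixWord (rows cols : List α) (M : α → α → Bool) :
    (matrixWord rows cols M).length = rows.length * (cols.length + 1) := by
  induction rows with
  | nil => simp [matrixWord]
  | cons i rows ih =>
    rw [matrixWord, List.flatMap_cons, List.length_append, ← matrixWord, ih]
    simp only [List.length_append, length_word, List.length_cons, List.length_nil]
    ring

/-- One round of the main loop that does not find the empty set. -/
theorem runs_round (l : List α) (M : α → α → Bool) (q : α → Bool)
    (h : (l.any fun i => twice l (M i) q) = true) :
    Runs (4 * (l.length + 1) ^ 2) (.row 0 false)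
      (contents (matrixWord l l M) [] (word l q) [] []) (.row 0 false)
      (contents (matrixWord l l M) [] (word l fun i => twice l (M i) q) [] []) := by
  have h₁ := runs_rows false l l M q [] []
  rw [h] at h₁
  have h₂ : Runs 1 (.row 0 (false || true))
      (contents [] ((matrixWord l l M).reverse ++ []) (word l q) []
        ((word l fun i => twice l (M i) q).reverse ++ [])) .clearSet
      (contents [] (matrixWord l l M).reverse (word l q) []
        (word l fun i => twice l (M i) q).reverse) :=
    .step fun v => ⟨none, by simp [program]⟩
  have h₃ := runs_clearSet (word l q) [] (matrixWord l l M).reverse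
    (word l fun i => twice l (M i) q).reverse
  have h₄ := runs_moveNext (word l fun i => twice l (M i) q).reverse []
    (matrixWord l l M).reverse []
  have h₅ := runs_rewind (matrixWord l l M).reverse []
    ((word l fun i => twice l (M i) q).reverse.reverse ++ [])
  have := (((h₁.trans h₂ le_rfl).trans h₃ le_rfl).trans h₄ le_rfl).trans h₅
    (t := 4 * (l.length + 1) ^ 2)
    -- With `n` the length of `l`, the phases add up to `4n² + 6n + 4`.
    (by simp only [length_word, List.length_reverse, length_matrixWord]; ring_nf; omega)
  simpa using this

theorem runs_scan (c : Fin 3) (l : List α) (q : α → Bool) (m' a' b : List Symb) :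
    Runs (l.length + 1) (.scan c) (contents [] m' (word l q) a' b)
      (output (satCount q c l))
      (contents [] m' [] ((word l q).reverse ++ a') ((word l q).reverse ++ b)) := by
  induction l generalizing c a' b with
  | nil => exact .step fun v => ⟨none, by simp [program, satCount]⟩
  | cons x l ih =>
    refine .trans (t₁ := 1) (.step fun v => ⟨some (sym (q x)), ?_⟩)
      (by simpa using ih (bump c (q x)) (sym (q x) :: a') (sym (q x) :: b)) (by simp; omega)
    simp [program]

/-- The round of the main loop that finds the empty set. -/
theorem runs_last_round (l : List α) (M : α → α → Bool) (q : α → Bool)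
    (h : (l.any fun i => twice l (M i) q) = false) :
    Runs (4 * (l.length + 1) ^ 2) (.row 0 false)
      (contents (matrixWord l l M) [] (word l q) [] [])
      (if 2 ≤ l.countP q then .edge else .single)
      (contents [] (matrixWord l l M).reverse [] (word l q).reverse (word l q).reverse) := by
  have h₁ := runs_rows false l l M q [] []
  rw [h] at h₁
  have h₂ : Runs 1 (.row 0 (false || false))
      (contents [] ((matrixWord l l M).reverse ++ []) (word l q) []
        ((word l fun i => twice l (M i) q).reverse ++ [])) .clearNext
      (contents [] (matrixWord l l M).reverse (word l q) []
        (word l fun i => twice l (M i) q).reverse) :=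
    .step fun v => ⟨none, by simp [program]⟩
  have h₃ := runs_clearNext (word l fun i => twice l (M i) q).reverse []
    (matrixWord l l M).reverse (word l q)
  have h₄ := runs_scan 0 l q (matrixWord l l M).reverse [] []
  have := ((h₁.trans h₂ le_rfl).trans h₃ le_rfl).trans h₄ (t := 4 * (l.length + 1) ^ 2)
    (by simp only [length_word, List.length_reverse]; ring_nf; omega)
  simpa [output, satCount_eq_two_iff] using this

/-! ### Writing the output -/

/-- The bit `s` says whether the vertex of this row is an end of the edge. The entry is cleared only
if the column also belongs to an end. Since writing goes backwards, `s` itself comes last, as the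
entry in the column of the new vertex. -/
theorem runs_edge_bits (s : Bool) (l : List α) (p q : α → Bool) (m m' a b : List Symb) :
    Runs (2 * l.length + 1) (.edgeRow s) (contents m (word l p ++ m') a (word l q) b) .edgeRewind
      (contents (sym s :: ((word l fun j => p j && !(s && q j)).reverse ++ m)) m'
        ((word l q).reverse ++ a) [] b) := by
  induction l generalizing m a with
  | nil => exact .step fun v => ⟨none, by simp [program]⟩
  | cons x l ih =>
    have h₁ : Runs 1 (.edgeRow s)
        (contents m (word (x :: l) p ++ m') a (word (x :: l) q) b) (.edgeBit s (q x))
        (contents m (word (x :: l) p ++ m') (sym (q x) :: a) (word l q) b) :=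
      .step fun v => ⟨some (sym (q x)), by simp [program]⟩
    have h₂ : Runs 1 (.edgeBit s (q x))
        (contents m (word (x :: l) p ++ m') (sym (q x) :: a) (word l q) b) (.edgeRow s)
        (contents (sym (p x && !(s && q x)) :: m) (word l p ++ m') (sym (q x) :: a)
          (word l q) b) :=
      .step fun v => ⟨some (sym (p x)), by simp [program]⟩
    refine (h₁.trans h₂ le_rfl).trans (t₂ := 2 * l.length + 1) ?_ (by simp; omega)
    simpa using ih (sym (p x && !(s && q x)) :: m) (sym (q x) :: a)

theorem runs_edge_row (s : Bool) (l : List α) (p q : α → Bool) (m m' b : List Symb) :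
    Runs (3 * l.length + 4) .edge
      (contents m ((word l p ++ [Symb.sep]).reverse ++ m') [] (word l q).reverse (sym s :: b)) .edge
      (contents (sym s :: ((word l fun j => p j && !(s && q j)) ++ .sep :: m)) m' []
        (word l q).reverse b) := by
  have h₁ : Runs 1 .edge
      (contents m ((word l p ++ [Symb.sep]).reverse ++ m') [] (word l q).reverse (sym s :: b))
      .edgeFetch
      (contents (.sep :: m) (word l.reverse p ++ m') [] (word l.reverse q) (sym s :: b)) :=
    .step fun v => ⟨some .sep, by simp [program]⟩
  have h₂ : Runs 1 .edgeFetch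
      (contents (.sep :: m) (word l.reverse p ++ m') [] (word l.reverse q) (sym s :: b))
      (.edgeRow s) (contents (.sep :: m) (word l.reverse p ++ m') [] (word l.reverse q) b) :=
    .step fun v => ⟨some (sym s), by simp [program]⟩
  have h₃ := runs_edge_bits s l.reverse p q (.sep :: m) m' [] b
  have h₄ := runs_edgeRewind ((word l.reverse q).reverse ++ [])
    (sym s :: ((word l.reverse fun j => p j && !(s && q j)).reverse ++ .sep :: m)) m' [] b
  have := ((h₁.trans h₂ le_rfl).trans h₃ le_rfl).trans h₄ (t := 3 * l.length + 4)
    (by simp; omega)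
  simpa using this

/-- The induction splits off the last row because the stacks hold the matrix and the set reversed,
so the last row is processed first. -/
theorem runs_edge_rows (rows cols : List α) (M : α → α → Bool) (q : α → Bool) (m : List Symb) :
    Runs (rows.length * (3 * cols.length + 4)) .edge
      (contents m (matrixWord rows cols M).reverse [] (word cols q).reverse (word rows q).reverse)
      .edge (contents ((rows.flatMap fun i =>
        sym (q i) :: (word cols (fun j => M i j && !(q i && q j)) ++ [Symb.sep])) ++ m)
        [] [] (word cols q).reverse []) := by
  induction rows using List.reverseRecOn generalizing m with
  | nil => simpa [matrixWord] using Runs.refl _ _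
  | append_singleton rows i ih =>
    have h₁ := runs_edge_row (q i) cols (M i) q m (matrixWord rows cols M).reverse
      (word rows q).reverse
    have h₂ := ih (sym (q i) :: ((word cols fun j => M i j && !(q i && q j)) ++ .sep :: m))
    have := h₁.trans h₂ (t := (rows ++ [i]).length * (3 * cols.length + 4))
      (by simp only [List.length_append, List.length_cons, List.length_nil]; ring_nf; omega)
    simpa [matrixWord] using this

/-- The output for a fixed edge. -/
theorem runs_edge (l : List α) (M : α → α → Bool) (q : α → Bool) :
    Runs (4 * (l.length + 1) ^ 2) .edge
      (contents [] (matrixWord l l M).reverse [] (word l q).reverse (word l q).reverse) .done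
      (contents (.sep :: .zero :: (word l q ++ .sep :: l.flatMap fun i =>
        sym (q i) :: (word l (fun j => M i j && !(q i && q j)) ++ [Symb.sep]))) [] [] [] []) := by
  have h₁ := runs_edge_rows l l M q []
  set out := l.flatMap fun i =>
    sym (q i) :: (word l (fun j => M i j && !(q i && q j)) ++ [Symb.sep]) with hout
  have h₂ : Runs 1 .edge (contents (out ++ []) [] [] (word l q).reverse []) .lastRow
      (contents (.sep :: out) [] [] (word l q).reverse []) :=
    .step fun v => ⟨none, by simp [program]⟩
  have h₃ := runs_lastRow (word l q).reverse (.sep :: out)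
  have := (h₁.trans h₂ le_rfl).trans h₃ (t := 4 * (l.length + 1) ^ 2)
    (by simp only [length_word, List.length_reverse]; ring_nf; omega)
  simpa using this

/-- The output for a fixed vertex. -/
theorem runs_vertex (m' : List Symb) (i k : ℕ) :
    Runs (m'.length + i + k + 3) .single
      (contents [] m' [] (List.replicate k .zero ++ .one :: List.replicate i .zero)
        (List.replicate k .zero ++ .one :: List.replicate i .zero)) .done
      (contents (List.replicate i .one ++ .sep :: m'.reverse) [] [] [] []) := by
  have h₁ := runs_single m' [] (List.replicate k .zero ++ .one :: List.replicate i .zero)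
    (List.replicate k .zero ++ .one :: List.replicate i .zero)
  have h₂ := runs_skip k (List.replicate i .zero) (.sep :: (m'.reverse ++ []))
  have h₃ := runs_unary (List.replicate i .zero) (.sep :: (m'.reverse ++ []))
  have := (h₁.trans h₂ le_rfl).trans h₃ (t := m'.length + i + k + 3) (by simp; omega)
  simpa using this

end

end TreeRooting

/-! ### Repeated removal of leaves -/

namespace TreeRooting

section
variable {V : Type*} (X : SimpleGraph V)

/-- The vertices with at least two neighbours in `S`. -/
def twoNbrs (S : Set V) : Set V := {i | ∃ j ∈ S, ∃ k ∈ S, j ≠ k ∧ X.Adj i j ∧ X.Adj i k}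

/-- The vertex sets obtained by repeatedly removing all leaves. -/
def core (k : ℕ) : Set V := (twoNbrs X)^[k] Set.univ

theorem core_zero : core X 0 = Set.univ := rfl

theorem core_succ (k : ℕ) : core X (k + 1) = twoNbrs X (core X k) :=
  Function.iterate_succ_apply' _ _ _

theorem twoNbrs_mono {S S' : Set V} (h : S ⊆ S') : twoNbrs X S ⊆ twoNbrs X S' := by
  rintro i ⟨j, hj, k, hk, r⟩
  exact ⟨j, h hj, k, h hk, r⟩

/-- The first inclusion is trivial and monotonicity propagates it. For this reason `twoNbrs` need
not require its elements to lie in `S`, and the machine need not test it. -/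
theorem core_succ_subset (k : ℕ) : core X (k + 1) ⊆ core X k := by
  induction k with
  | zero => exact Set.subset_univ _
  | succ k ih =>
    rw [core_succ X (k + 1)]
    nth_rw 2 [core_succ]
    exact twoNbrs_mono X ih

theorem apply_mem_core (g : X ≃g X) {k : ℕ} {v : V} (hv : v ∈ core X k) : g v ∈ core X k := by
  induction k generalizing v with
  | zero => trivial
  | succ k ih =>
    rw [core_succ] at hv ⊢
    obtain ⟨i, hi, j, hj, hij, h₁, h₂⟩ := hv
    exact ⟨g i, ih hi, g j, ih hj, g.injective.ne hij, g.map_adj_iff.2 h₁, g.map_adj_iff.2 h₂⟩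

/-- A vertex set is convex if it contains all paths between its vertices. -/
def PathConvex (S : Set V) : Prop :=
  ∀ ⦃u v : V⦄ (p : X.Walk u v), p.IsPath → u ∈ S → v ∈ S → ∀ x ∈ p.support, x ∈ S

variable {X}

theorem exists_two_nbrs_of_mem_path {u v x : V} (p : X.Walk u v) (hp : p.IsPath)
    (hx : x ∈ p.support) (hu : x ≠ u) (hv : x ≠ v) :
    ∃ y ∈ p.support, ∃ z ∈ p.support, y ≠ z ∧ X.Adj x y ∧ X.Adj x z := by
  induction p with
  | nil => simp at hx; exact absurd hx hu
  | @cons a b c h p ih =>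
    rw [SimpleGraph.Walk.cons_isPath_iff] at hp
    have hx' : x ∈ p.support := by simpa [hu] using hx
    by_cases hb : x = b
    · subst hb
      cases p with
      | nil => exact absurd rfl hv
      | @cons _ d _ h' p' =>
        refine ⟨a, by simp, d, by simp, ?_, h.symm, h'⟩
        rintro rfl
        exact hp.2 (by simp)
    · obtain ⟨y, hy, z, hz, r⟩ := ih hp.1 hx' hb hv
      exact ⟨y, by simp [hy], z, by simp [hz], r⟩

/-- Inner vertices of a path have two neighbours on it, and these lie in `S` by convexity; the ends
are given. -/
theorem PathConvex.twoNbrs {S : Set V} (hS : PathConvex X S) (h : twoNbrs X S ⊆ S) :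
    PathConvex X (twoNbrs X S) := by
  intro u v p hp hu hv x hx
  by_cases hxu : x = u
  · exact hxu ▸ hu
  by_cases hxv : x = v
  · exact hxv ▸ hv
  obtain ⟨y, hy, z, hz, r⟩ := exists_two_nbrs_of_mem_path p hp hx hxu hxv
  have := hS p hp (h hu) (h hv)
  exact ⟨y, this y hy, z, this z hz, r⟩

theorem pathConvex_core (k : ℕ) : PathConvex X (core X k) := by
  induction k with
  | zero => intro _ _ _ _ _ _ _ _; trivial
  | succ k ih =>
    rw [core_succ]
    exact ih.twoNbrs (core_succ X k ▸ core_succ_subset X k)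

/-- Convexity makes the induced graph on `S` connected, hence a tree. If every vertex had two
neighbours in `S`, this tree would be nontrivial and without a vertex of degree one. -/
theorem PathConvex.not_subset_twoNbrs [Finite V] (hX : X.IsTree) {S : Set V}
    (hS : PathConvex X S) (hne : S.Nonempty) : ¬ S ⊆ TreeRooting.twoNbrs X S := by
  classical
  intro h
  have := Fintype.ofFinite V
  have hT : (X.induce S).IsTree := by
    refine ⟨?_, hX.isAcyclic.induce S⟩
    have := hne.to_subtype
    refine ⟨fun u v => ?_⟩
    obtain ⟨p, hp⟩ := (hX.existsUnique_path u v).exists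
    exact ⟨p.induce S fun x hx => hS p hp u.2 v.2 x hx⟩
  obtain ⟨v, hv⟩ := hne
  obtain ⟨j, hj, k, hk, hjk, -, -⟩ := h hv
  have : Nontrivial S := ⟨⟨⟨j, hj⟩, ⟨k, hk⟩, by simpa using hjk⟩⟩
  obtain ⟨v, hv⟩ := hT.exists_vert_degree_one_of_nontrivial
  obtain ⟨j, hj, k, hk, hjk, hvj, hvk⟩ := h v.2
  obtain ⟨w, hw⟩ := Finset.card_eq_one.1 hv
  have h₁ : (⟨j, hj⟩ : S) ∈ (X.induce S).neighborFinset v := by simpa using hvj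
  have h₂ : (⟨k, hk⟩ : S) ∈ (X.induce S).neighborFinset v := by simpa using hvk
  rw [hw, Finset.mem_singleton] at h₁ h₂
  exact hjk (congrArg Subtype.val (h₁.trans h₂.symm))

/-- Every stage before a nonempty one has lost at least one vertex; this bounds the number of
rounds. -/
theorem ncard_core_add_le [Finite V] (hX : X.IsTree) {k : ℕ} (hne : (core X k).Nonempty) :
    (core X k).ncard + k ≤ Nat.card V := by
  induction k with
  | zero => simp [core_zero, Set.ncard_univ]
  | succ k ih =>
    have hsub := core_succ_subset X k
    have hne' := hne.mono hsub
    have hlt : (core X (k + 1)).ncard < (core X k).ncard := by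
      refine Set.ncard_lt_ncard ⟨hsub, ?_⟩ (Set.toFinite _)
      rw [core_succ]
      exact (pathConvex_core k).not_subset_twoNbrs hX hne'
    have := ih hne'
    omega

/-- The last nonempty set in the process of removing leaves. -/
theorem exists_last_core [Finite V] (hX : X.IsTree) :
    ∃ k < Nat.card V, (core X k).Nonempty ∧ core X (k + 1) = ∅ := by
  classical
  have hfin : ∃ k, ¬ (core X k).Nonempty := by
    refine ⟨Nat.card V + 1, fun h => ?_⟩
    have := ncard_core_add_le hX h
    omega
  have hspec := Nat.find_spec hfin
  have hmin := @Nat.find_min _ _ hfin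
  obtain ⟨k, hk⟩ : ∃ k, Nat.find hfin = k + 1 := by
    refine Nat.exists_eq_succ_of_ne_zero fun h => ?_
    rw [h] at hspec
    have := hX.connected.nonempty
    exact hspec ⟨Classical.arbitrary V, trivial⟩
  have hne : (core X k).Nonempty := not_not.1 (hmin (by omega))
  refine ⟨k, ?_, hne, Set.not_nonempty_iff_eq_empty.1 (hk ▸ hspec)⟩
  have := ncard_core_add_le hX hne
  have := (Set.ncard_pos (Set.toFinite _)).2 hne
  omega

/-- On a path of length at least two in `S`, the second vertex would have two neighbours in `S`. -/
theorem PathConvex.adj_of_twoNbrs_eq_empty (hX : X.Connected) {S : Set V} (hS : PathConvex X S)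
    (h : TreeRooting.twoNbrs X S = ∅) {u v : V} (hu : u ∈ S) (hv : v ∈ S) (huv : u ≠ v) :
    X.Adj u v := by
  obtain ⟨p, hp⟩ := (hX u v).exists_isPath
  cases p with
  | nil => exact absurd rfl huv
  | @cons _ b _ h₁ q =>
    by_cases hb : b = v
    · exact hb ▸ h₁
    · have hb' : b ∈ (SimpleGraph.Walk.cons h₁ q).support := by simp
      obtain ⟨y, hy, z, hz, r⟩ := exists_two_nbrs_of_mem_path _ hp hb' h₁.ne' hb
      have := hS _ hp hu hv
      exact absurd (show b ∈ TreeRooting.twoNbrs X S from ⟨y, this y hy, z, this z hz, r⟩)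
        (h ▸ Set.notMem_empty b)

/-- A convex set without vertices with two neighbours in it is a vertex or an edge. -/
theorem PathConvex.eq_singleton_or_pair (hX : X.Connected) {S : Set V} (hS : PathConvex X S)
    (hne : S.Nonempty) (h : TreeRooting.twoNbrs X S = ∅) :
    (∃ α, S = {α}) ∨ ∃ α β, X.Adj α β ∧ S = {α, β} := by
  obtain ⟨α, hα⟩ := hne
  by_cases hβ : ∃ β ∈ S, β ≠ α
  · obtain ⟨β, hβ, hne⟩ := hβ
    have hadj {u v : V} (hu : u ∈ S) (hv : v ∈ S) (huv : u ≠ v) : X.Adj u v :=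
      hS.adj_of_twoNbrs_eq_empty hX h hu hv huv
    refine .inr ⟨α, β, hadj hα hβ hne.symm, Set.Subset.antisymm ?_ ?_⟩
    swap
    · rintro x (rfl | rfl) <;> assumption
    intro x hx
    by_contra hx'
    simp only [Set.mem_insert_iff, Set.mem_singleton_iff, not_or] at hx'
    exact absurd (show x ∈ TreeRooting.twoNbrs X S from
      ⟨α, hα, β, hβ, hne.symm, hadj hx hα hx'.1, hadj hx hβ hx'.2⟩) (h ▸ Set.notMem_empty x)
  · push Not at hβ
    exact .inl ⟨α, Set.Subset.antisymm hβ (by simpa using hα)⟩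

end

/-! ### Subdividing an edge -/

section
variable {n : ℕ} (X : SimpleGraph (Fin n)) (S : Set (Fin n))

/-- A new vertex `0` is joined to the vertices in `S`, and the edges within `S` are removed. -/
def attach : SimpleGraph (Fin (n + 1)) where
  Adj u v := (∃ i j, u = Fin.succ i ∧ v = Fin.succ j ∧ X.Adj i j ∧ ¬ (i ∈ S ∧ j ∈ S)) ∨
    (u = 0 ∧ ∃ j ∈ S, v = Fin.succ j) ∨ (v = 0 ∧ ∃ j ∈ S, u = Fin.succ j)
  symm := ⟨by
    rintro u v (⟨i, j, rfl, rfl, h, h'⟩ | h | h)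
    · exact .inl ⟨j, i, rfl, rfl, h.symm, fun h => h' h.symm⟩
    · exact .inr (.inr h)
    · exact .inr (.inl h)⟩
  loopless := ⟨by
    rintro u (⟨i, j, hi, hj, h, -⟩ | ⟨h, j, -, h'⟩ | ⟨h, j, -, h'⟩)
    · exact h.ne (Fin.succ_injective _ (hi.symm.trans hj))
    · exact Fin.succ_ne_zero j (h'.symm.trans h)
    · exact Fin.succ_ne_zero j (h'.symm.trans h)⟩

@[simp] theorem attach_succ_succ (i j : Fin n) :
    (attach X S).Adj i.succ j.succ ↔ X.Adj i j ∧ ¬ (i ∈ S ∧ j ∈ S) := by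
  simp [attach, Fin.succ_ne_zero]

@[simp] theorem attach_zero_succ (j : Fin n) : (attach X S).Adj 0 j.succ ↔ j ∈ S := by
  simp [attach, (Fin.succ_ne_zero _).symm]

@[simp] theorem attach_succ_zero (j : Fin n) : (attach X S).Adj j.succ 0 ↔ j ∈ S := by
  rw [SimpleGraph.adj_comm, attach_zero_succ]

variable {X}

/-- An edge of `X` either survives or has both ends in `S`, and then it is replaced by a detour
through `0`. -/
theorem attach_connected (hX : X.Connected) {S : Set (Fin n)} (hS : S.Nonempty) :
    (attach X S).Connected := by
  have key : ∀ i j, (attach X S).Reachable (Fin.succ i) (Fin.succ j) := by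
    intro i j
    obtain ⟨p⟩ := hX i j
    induction p with
    | nil => rfl
    | @cons a b c h p ih =>
      refine .trans ?_ ih
      by_cases hab : a ∈ S ∧ b ∈ S
      · exact .trans ((attach_succ_zero X S a).2 hab.1).reachable
          ((attach_zero_succ X S b).2 hab.2).reachable
      · exact ((attach_succ_succ X S a b).2 ⟨h, hab⟩).reachable
  obtain ⟨s, hs⟩ := hS
  have h0 : (attach X S).Reachable 0 s.succ := ((attach_zero_succ X S s).2 hs).reachable
  refine ⟨fun u v => ?_⟩
  refine Fin.cases ?_ (fun i => ?_) u <;> refine Fin.cases ?_ (fun j => ?_) v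
  · rfl
  · exact h0.trans (key _ _)
  · exact (key _ _).trans h0.symm
  · exact key _ _

theorem not_mem_pair_iff {α β i j : Fin n} (h : X.Adj i j) :
    ¬ (i ∈ ({α, β} : Set (Fin n)) ∧ j ∈ ({α, β} : Set (Fin n))) ↔ s(i, j) ≠ s(α, β) := by
  have := h.ne
  simp only [Set.mem_insert_iff, Set.mem_singleton_iff, ne_eq, Sym2.eq_iff]
  grind

/-- Connectedness is known, so counting suffices: one edge is lost, two edges and one vertex are
gained. -/
theorem attach_pair_isTree (hX : X.IsTree) {α β : Fin n} (h : X.Adj α β) :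
    (attach X {α, β}).IsTree := by
  rw [SimpleGraph.isTree_iff_connected_and_card]
  refine ⟨attach_connected hX.connected ⟨α, by simp⟩, ?_⟩
  have hcard := (SimpleGraph.isTree_iff_connected_and_card.1 hX).2
  let e : Sym2 (Fin n) → Sym2 (Fin (n + 1)) := Sym2.map Fin.succ
  have he : Function.Injective e := Sym2.map.injective (Fin.succ_injective n)
  have hzero (E : Set (Sym2 (Fin n))) (u : Fin (n + 1)) : s(0, u) ∉ e '' E := by
    rintro ⟨x, -, hx⟩
    have : (0 : Fin (n + 1)) ∈ e x := hx ▸ Sym2.mem_mk_left 0 u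
    obtain ⟨i, -, hi⟩ := Sym2.mem_map.1 this
    exact Fin.succ_ne_zero i hi
  have heq : (attach X {α, β}).edgeSet =
      insert s(0, α.succ) (insert s(0, β.succ) (e '' (X.edgeSet \ {s(α, β)}))) := by
    have hmem (j : Fin n) : s(0, j.succ) ∈ (attach X {α, β}).edgeSet ↔ s(0, j.succ) ∈
        insert s(0, α.succ) (insert s(0, β.succ) (e '' (X.edgeSet \ {s(α, β)}))) := by
      simp [hzero]
    ext x
    induction x with | _ u v
    refine Fin.cases ?_ (fun i => ?_) u <;> refine Fin.cases ?_ (fun j => ?_) v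
    · simp [hzero, (Fin.succ_ne_zero _).symm]
    · exact hmem j
    · rw [Sym2.eq_swap]
      exact hmem i
    · have hi : s(i.succ, j.succ) = e s(i, j) := rfl
      have h0 (k : Fin n) : s(i.succ, j.succ) ≠ s(0, k.succ) := by
        simp [Fin.succ_ne_zero]
      rw [Set.mem_insert_iff, Set.mem_insert_iff, or_iff_right (h0 _), or_iff_right (h0 _), hi,
        he.mem_set_image, ← hi, SimpleGraph.mem_edgeSet, attach_succ_succ]
      exact and_congr_right fun hij => not_mem_pair_iff hij
  have hmem : s(α, β) ∈ X.edgeSet := h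
  have hαβ : s((0 : Fin (n + 1)), α.succ) ≠ s(0, β.succ) := by
    simpa [Fin.succ_ne_zero] using h.ne
  rw [Nat.card_coe_set_eq] at hcard ⊢
  have hpos := (Set.ncard_pos (Set.toFinite _)).2 ⟨_, hmem⟩
  rw [heq, Set.ncard_insert_of_notMem (by simp [hzero, h.ne]),
    Set.ncard_insert_of_notMem (hzero _ _),
    Set.ncard_image_of_injective _ he, Set.ncard_sdiff_singleton_of_mem hmem]
  simp only [Nat.card_fin] at hcard ⊢
  omega

variable {S}

/-- The automorphism of `attach X S` that fixes the new vertex and extends `g`. -/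
def extendAut (g : X ≃g X) (hg : ∀ v, g v ∈ S ↔ v ∈ S) : attach X S ≃g attach X S where
  toFun := Fin.cases 0 fun i => (g i).succ
  invFun := Fin.cases 0 fun i => (g.symm i).succ
  left_inv u := by refine Fin.cases ?_ (fun i => ?_) u <;> simp
  right_inv u := by refine Fin.cases ?_ (fun i => ?_) u <;> simp
  map_rel_iff' := by
    intro u v
    refine Fin.cases ?_ (fun i => ?_) u <;> refine Fin.cases ?_ (fun j => ?_) v <;>
      simp [hg, g.map_adj_iff]

@[simp] theorem extendAut_zero (g : X ≃g X) (hg : ∀ v, g v ∈ S ↔ v ∈ S) :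
    extendAut g hg 0 = 0 := rfl

/-- Every automorphism of `attach X S` that fixes the new vertex is an extension, if any two
vertices of `S` are adjacent. -/
theorem exists_extendAut_eq (hS : S.Pairwise X.Adj) (h : attach X S ≃g attach X S)
    (h0 : h 0 = 0) : ∃ g : X ≃g X, ∀ i : Fin n, h i.succ = (g i).succ := by
  have h0' : h.symm 0 = 0 := by rw [RelIso.symm_apply_eq, h0]
  have hne (i : Fin n) : h i.succ ≠ 0 := fun e =>
    Fin.succ_ne_zero i (h.injective (e.trans h0.symm))
  have hne' (i : Fin n) : h.symm i.succ ≠ 0 := fun e =>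
    Fin.succ_ne_zero i (h.symm.injective (e.trans h0'.symm))
  choose r hr using fun i => Fin.exists_succ_eq.2 (hne i)
  choose r' hr' using fun i => Fin.exists_succ_eq.2 (hne' i)
  -- `S` is the neighbourhood of the fixed vertex `0`.
  have hrS (i : Fin n) : r i ∈ S ↔ i ∈ S := by
    rw [← attach_zero_succ X, ← attach_zero_succ X S i, hr]
    nth_rw 1 [← h0]
    exact h.map_adj_iff
  have hrinj : Function.Injective r := fun i j e =>
    Fin.succ_injective _ (h.injective (by rw [← hr, ← hr, e]))
  -- As `S` is a clique, the edges deleted from `X` can be recovered from `S` alone.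
  have hadj (i j : Fin n) : X.Adj i j ↔ (attach X S).Adj i.succ j.succ ∨ i ∈ S ∧ j ∈ S ∧ i ≠ j := by
    rw [attach_succ_succ]
    constructor
    · intro hij
      by_cases hc : i ∈ S ∧ j ∈ S
      · exact .inr ⟨hc.1, hc.2, hij.ne⟩
      · exact .inl ⟨hij, hc⟩
    · rintro (hij | ⟨hi, hj, hij⟩)
      · exact hij.1
      · exact hS hi hj hij
  refine ⟨⟨⟨r, r', fun i => ?_, fun i => ?_⟩, ?_⟩, fun i => (hr i).symm⟩
  · apply Fin.succ_injective
    rw [hr', hr, RelIso.symm_apply_apply]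
  · apply Fin.succ_injective
    rw [hr, hr', RelIso.apply_symm_apply]
  · intro i j
    change X.Adj (r i) (r j) ↔ X.Adj i j
    rw [hadj, hadj i j, hr, hr, h.map_adj_iff, hrS, hrS, hrinj.ne_iff]

end

/-! ### Comparing the automorphism groups -/

theorem representable_iff_of_mulEquiv {V W : Type*} {X : SimpleGraph V} {Y : SimpleGraph W} {r : W}
    (Φ : (X ≃g X) ≃* rootedAut Y r) (G : Type*) [Group G] :
    Representable G X ↔ RootedRepresentable G Y r := by
  constructor
  · rintro ⟨ρ, g, hg⟩
    exact ⟨Φ.toMonoidHom.comp ρ, g, by simpa using hg⟩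
  · rintro ⟨ρ, g, hg⟩
    exact ⟨Φ.symm.toMonoidHom.comp ρ, g, by simpa using hg⟩

/-- The tree `T`, rooted at `α`. -/
def FinTree.rootAt (T : FinTree) (α : Fin T.n) : RootedFinTree := ⟨T, α⟩

theorem rootAt_sameAutomorphisms (T : FinTree) (α : Fin T.n)
    (h : ∀ g : T.graph ≃g T.graph, g α = α) :
    SameAutomorphisms T (T.rootAt α) (Function.Embedding.refl _) := by
  have htop : rootedAut T.graph α = ⊤ := top_unique fun g _ => h g
  exact ⟨Subgroup.topEquiv.symm.trans (MulEquiv.subgroupCongr htop.symm), fun g v => rfl⟩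

/-- The tree obtained from `T` by subdividing an edge with ends `S`, rooted at the new vertex. -/
def FinTree.subdivide (T : FinTree) (S : Set (Fin T.n)) (h : (attach T.graph S).IsTree) :
    RootedFinTree :=
  ⟨⟨T.n + 1, attach T.graph S, h⟩, (0 : Fin (T.n + 1))⟩

theorem subdivide_sameAutomorphisms (T : FinTree) {S : Set (Fin T.n)}
    (h : (attach T.graph S).IsTree) (hS : S.Pairwise T.graph.Adj)
    (hg : ∀ (g : T.graph ≃g T.graph) (v), g v ∈ S ↔ v ∈ S) :
    SameAutomorphisms T (T.subdivide S h) (Fin.succEmb T.n) := by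
  let φ : (T.graph ≃g T.graph) →* rootedAut (attach T.graph S) 0 :=
    { toFun g := ⟨extendAut g (hg g), extendAut_zero g (hg g)⟩
      map_one' := by
        ext u : 2
        refine Fin.cases ?_ (fun i => ?_) u <;> rfl
      map_mul' g g' := by
        ext u : 2
        refine Fin.cases ?_ (fun i => ?_) u <;> rfl }
  have hφ (g : T.graph ≃g T.graph) (v : Fin T.n) :
    (φ g : attach T.graph S ≃g attach T.graph S) v.succ = (g v).succ := rfl
  have hbij : Function.Bijective φ := by
    constructor
    · intro g g' e
      ext v : 1
      apply Fin.succ_injective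
      rw [← hφ, ← hφ, e]
    · rintro ⟨k, hk⟩
      obtain ⟨g, hkg⟩ := exists_extendAut_eq hS k hk
      refine ⟨g, ?_⟩
      ext u : 2
      refine Fin.cases ?_ (fun i => ?_) u
      · exact hk.symm
      · exact (hkg i).symm
  exact ⟨MulEquiv.ofBijective φ hbij, fun g v => rfl⟩

end TreeRooting

/-! ### Adjacency matrices as words -/

namespace TreeRooting

open Turing

section
open Classical
variable {n : ℕ} (X : SimpleGraph (Fin n))

/-- The adjacency matrix as a matrix of bits. -/
noncomputable def adjBit (i j : Fin n) : Bool := decide (X.Adj i j)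

/-- The characteristic function of a set, as bits. -/
noncomputable def memBit (S : Set (Fin n)) (i : Fin n) : Bool := decide (i ∈ S)

theorem encodeRow_eq (i : Fin n) :
    encodeRow X i = word (List.finRange n) (adjBit X i) ++ [Symb.sep] := by
  simp [encodeRow, word, adjBit, sym, List.ofFn_eq_map]

theorem encodeGraph_eq :
    encodeGraph X = matrixWord (List.finRange n) (List.finRange n) (adjBit X) := by
  rw [encodeGraph, matrixWord, funext (encodeRow_eq X)]

theorem two_le_countP_finRange_iff (p : Fin n → Bool) :
    2 ≤ (List.finRange n).countP p ↔ ∃ i j, p i ∧ p j ∧ i ≠ j := by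
  have h : (List.finRange n).countP p = (Finset.univ.filter fun i => p i = true).card := by
    rw [List.countP_eq_length_filter, ← List.toFinset_card_of_nodup
      ((List.nodup_finRange n).filter _)]
    congr 1
    ext i
    simp
  rw [h, Nat.succ_le_iff, Finset.one_lt_card]
  simp

theorem twice_adjBit (S : Set (Fin n)) (i : Fin n) :
    twice (List.finRange n) (adjBit X i) (memBit S) = memBit (twoNbrs X S) i := by
  rw [twice, memBit, decide_eq_decide, two_le_countP_finRange_iff]
  simp only [adjBit, memBit, twoNbrs, Bool.and_eq_true, decide_eq_true_eq, Set.mem_ofPred_eq]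
  grind

/-- This matches the output of `runs_edge`. Since the new vertex has label `0`, the old matrix only
gains an initial row and an initial column, and the unary label of the root is empty. -/
theorem encodeGraph_attach (S : Set (Fin n)) :
    encodeGraph (attach X S) = .zero :: (word (List.finRange n) (memBit S) ++ .sep ::
      (List.finRange n).flatMap fun i => sym (memBit S i) ::
        (word (List.finRange n) (fun j => adjBit X i j && !(memBit S i && memBit S j)) ++
          [Symb.sep])) := by
  rw [encodeGraph_eq, matrixWord, List.finRange_succ, List.flatMap_cons, List.flatMap_map]
  have h00 : adjBit (attach X S) 0 0 = false := by simp [adjBit]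
  have h0 (j : Fin n) : adjBit (attach X S) 0 j.succ = memBit S j := by simp [adjBit, memBit]
  have h1 (i : Fin n) : adjBit (attach X S) i.succ 0 = memBit S i := by simp [adjBit, memBit]
  have h2 (i j : Fin n) : adjBit (attach X S) i.succ j.succ =
      (adjBit X i j && !(memBit S i && memBit S j)) := by
    simp [adjBit, memBit]
  simp [word, h00, h0, h1, h2, Function.comp_def]
  rfl

theorem word_singleton (α : Fin n) :
    word (List.finRange n) (memBit {α}) = List.replicate (α : ℕ) .zero ++ .one ::
      List.replicate (n - 1 - α) .zero := by
  have := α.2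
  apply List.ext_getElem
  · simp; omega
  · intro i h₁ h₂
    rw [List.getElem_append]
    simp only [word, List.getElem_map, List.getElem_finRange, memBit, List.length_replicate,
      List.getElem_cons, Set.mem_singleton_iff, Fin.ext_iff, sym, List.getElem_replicate]
    simp
    grind

end

/-! ### The center and the rooted tree -/

section
open Classical

theorem exists_vertex_or_edge (T : FinTree) : ∃ S : Set (Fin T.n), ∃ k < T.n,
    S = core T.graph k ∧ twoNbrs T.graph S = ∅ ∧
    ((∃ α, S = {α}) ∨ ∃ α β, T.graph.Adj α β ∧ S = {α, β}) := by
  obtain ⟨k, hk, hne, he⟩ := exists_last_core T.isTree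
  rw [core_succ] at he
  exact ⟨_, k, by simpa using hk, rfl, he,
    (pathConvex_core k).eq_singleton_or_pair T.isTree.connected hne he⟩

/-- The vertex or edge that remains when the leaves are removed repeatedly. -/
noncomputable def FinTree.center (T : FinTree) : Set (Fin T.n) := (exists_vertex_or_edge T).choose

theorem FinTree.center_spec (T : FinTree) : ∃ k < T.n,
    T.center = core T.graph k ∧ twoNbrs T.graph T.center = ∅ ∧
    ((∃ α, T.center = {α}) ∨ ∃ α β, T.graph.Adj α β ∧ T.center = {α, β}) :=
  (exists_vertex_or_edge T).choose_spec

theorem FinTree.apply_mem_center (T : FinTree) (g : T.graph ≃g T.graph) (v : Fin T.n) :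
    g v ∈ T.center ↔ v ∈ T.center := by
  obtain ⟨k, -, hk, -⟩ := T.center_spec
  rw [hk]
  refine ⟨fun h => ?_, apply_mem_core _ g⟩
  simpa using apply_mem_core _ g.symm h

theorem FinTree.attach_center_isTree (T : FinTree) (h : ¬ ∃ α, T.center = {α}) :
    (attach T.graph T.center).IsTree := by
  obtain ⟨-, -, -, -, h' | ⟨α, β, hαβ, h'⟩⟩ := T.center_spec
  · exact absurd h' h
  · rw [h']
    exact attach_pair_isTree T.isTree hαβ

/-- The tree rooted at its center, which is subdivided if it is an edge. -/
noncomputable def FinTree.rooting (T : FinTree) : RootedFinTree :=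
  if h : ∃ α, T.center = {α} then T.rootAt h.choose
  else T.subdivide T.center (T.attach_center_isTree h)

theorem FinTree.rooting_spec (T : FinTree) : ∃ ι : Fin T.n ↪ Fin T.rooting.n,
    (IsRootingAtFixedVertex T T.rooting ι ∨ IsRootingAtFixedEdge T T.rooting ι) ∧
    SameAutomorphisms T T.rooting ι := by
  by_cases h : ∃ α, T.center = {α}
  · rw [FinTree.rooting, dif_pos h]
    have hα := h.choose_spec
    set α := h.choose
    have hfix (g : T.graph ≃g T.graph) : g α = α := by
      simpa [hα] using T.apply_mem_center g α
    exact ⟨Function.Embedding.refl _, .inl ⟨α, hfix, Function.surjective_id, fun _ _ => .rfl, rfl⟩,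
      rootAt_sameAutomorphisms T α hfix⟩
  · rw [FinTree.rooting, dif_neg h]
    have ht := T.attach_center_isTree h
    have hg := T.apply_mem_center
    obtain ⟨-, -, -, -, h' | ⟨α, β, hαβ, h'⟩⟩ := T.center_spec
    · exact absurd h' h
    refine ⟨Fin.succEmb T.n, .inr ⟨α, β, hαβ, fun g => ?_, ?_, fun u v => ?_, fun v => ?_⟩,
      subdivide_sameAutomorphisms T ht ?_ hg⟩
    · have h₁ : g α ∈ ({α, β} : Set (Fin T.n)) := h' ▸ (hg g α).2 (h' ▸ by simp)
      have h₂ : g β ∈ ({α, β} : Set (Fin T.n)) := h' ▸ (hg g β).2 (h' ▸ by simp)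
      -- An edge with both ends in `{α, β}` is the edge `αβ`.
      exact not_not.1 (mt (not_mem_pair_iff (g.map_adj_iff.2 hαβ)).2 (not_not.2 ⟨h₁, h₂⟩))
    · exact Fin.range_succ T.n
    · refine (attach_succ_succ T.graph T.center u v).trans (and_congr_right fun huv => ?_)
      rw [h']
      exact not_mem_pair_iff huv
    · refine (attach_zero_succ T.graph T.center v).trans ?_
      simp [h']
    · rw [h']
      rintro x (rfl | rfl) y (rfl | rfl) hxy
      exacts [absurd rfl hxy, hαβ, hαβ.symm, absurd rfl hxy]

/-! ### Correctness and running time of the machine -/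

theorem runs_core {n : ℕ} (X : SimpleGraph (Fin n)) (k : ℕ) (hk : (core X k).Nonempty) :
    Runs (k * (4 * (n + 1) ^ 2)) (.row 0 false)
      (contents (encodeGraph X) [] (List.replicate n .one) [] []) (.row 0 false)
      (contents (encodeGraph X) [] (word (List.finRange n) (memBit (core X k))) [] []) := by
  induction k with
  | zero =>
    have : word (List.finRange n) (memBit (core X 0)) = List.replicate n .one := by
      simp [word, memBit, core_zero, sym]
    rw [this, Nat.zero_mul]
    exact .refl _ _
  | succ k ih =>
    have h := runs_round (List.finRange n) (adjBit X) (memBit (core X k)) (by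
      obtain ⟨i, hi⟩ := hk
      rw [List.any_eq_true]
      refine ⟨i, List.mem_finRange i, ?_⟩
      rw [twice_adjBit, ← core_succ]
      simpa [memBit] using hi)
    simp only [twice_adjBit, ← core_succ, ← encodeGraph_eq, List.length_finRange] at h
    exact (ih (hk.mono (core_succ_subset X k))).trans h (by ring_nf; omega)

theorem runs_start {n : ℕ} (X : SimpleGraph (Fin n)) (hn : 0 < n) :
    Runs (2 * n + 3) .init (contents (encodeGraph X) [] [] [] []) (.row 0 false)
      (contents (encodeGraph X) [] (List.replicate n .one) [] []) := by
  obtain ⟨i, l, hl⟩ : ∃ i l, List.finRange n = i :: l := by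
    refine List.exists_cons_of_ne_nil fun h => ?_
    have := congrArg List.length h
    simp at this
    omega
  set w := word (List.finRange n) (adjBit X i)
  have hX : encodeGraph X = w ++ .sep :: matrixWord l (List.finRange n) (adjBit X) := by
    rw [encodeGraph_eq]
    -- Only the list of rows is split; the columns remain `List.finRange n`.
    conv_lhs => enter [1]; rw [hl]
    simp [matrixWord, w]
  have hw : w.length = n := by simp [w]
  have h₁ := runs_init w (matrixWord l (List.finRange n) (adjBit X)) [] [] (by
    intro x hx
    obtain ⟨j, -, rfl⟩ := List.mem_map.1 hx
    exact sym_ne_sep _)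
  have h₂ := runs_rewind (.sep :: w.reverse ++ []) (matrixWord l (List.finRange n) (adjBit X))
    (List.replicate w.length .one ++ [])
  have := h₁.trans h₂ (t := 2 * n + 3) (by simp [hw]; omega)
  rw [hX]
  simpa [hw] using this

/-- The machine makes `k` rounds to reach the center `core k`, one more to find that the next set is
empty, and then writes the output. The `- 1` in the bound leaves room for the halting step. -/
theorem runs_rooting (T : FinTree) :
    Runs (8 * (T.n + 1) ^ 3 - 1) .init (contents T.encode [] [] [] []) .done
      (contents T.rooting.encode [] [] [] []) := by
  obtain ⟨k, hk, hc, he, hcases⟩ := T.center_spec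
  have hn : 0 < T.n := by omega
  have hne : T.center.Nonempty := by
    rcases hcases with ⟨α, h⟩ | ⟨α, β, -, h⟩ <;> exact ⟨α, by simp [h]⟩
  have h₁ := (runs_start T.graph hn).trans (runs_core T.graph k (hc ▸ hne)) le_rfl
  rw [← hc] at h₁
  have h₂ := runs_last_round (List.finRange T.n) (adjBit T.graph) (memBit T.center) (by
    rw [List.any_eq_false]
    intro i _
    rw [twice_adjBit, he]
    simp [memBit])
  rw [← encodeGraph_eq, List.length_finRange] at h₂
  have htime : 2 * T.n + 3 + k * (4 * (T.n + 1) ^ 2) + 4 * (T.n + 1) ^ 2 + 4 * (T.n + 1) ^ 2 ≤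
      8 * (T.n + 1) ^ 3 - 1 := by
    have h : k * (4 * (T.n + 1) ^ 2) + 4 * (T.n + 1) ^ 2 ≤ 4 * (T.n + 1) ^ 3 := by
      calc _ = (k + 1) * (4 * (T.n + 1) ^ 2) := by ring
        _ ≤ (T.n + 1) * (4 * (T.n + 1) ^ 2) := Nat.mul_le_mul_right _ (by omega)
        _ = _ := by ring
    have h' : 2 * T.n + 4 + 4 * (T.n + 1) ^ 2 ≤ 4 * (T.n + 1) ^ 3 := by
      obtain ⟨m, hm⟩ := Nat.exists_eq_succ_of_ne_zero hn.ne'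
      rw [hm]
      ring_nf
      nlinarith
    omega
  by_cases h : ∃ α, T.center = {α}
  · have hroot : T.rooting = T.rootAt h.choose := dif_pos h
    have hα := h.choose_spec
    set α := h.choose
    have hcount : ¬ 2 ≤ (List.finRange T.n).countP (memBit T.center) := by
      rw [two_le_countP_finRange_iff]
      simp [memBit, hα]
    rw [if_neg hcount, hα, word_singleton] at h₂
    have h₃ := runs_vertex (encodeGraph T.graph).reverse (α : ℕ) (T.n - 1 - α)
    have hlen : (encodeGraph T.graph).length = T.n * (T.n + 1) := by
      rw [encodeGraph_eq, length_matrixWord, List.length_finRange]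
    have h₄ := h₃.mono (t' := 4 * (T.n + 1) ^ 2) (by
      rw [List.length_reverse, hlen]
      have := α.2
      ring_nf
      omega)
    rw [hroot]
    rw [hα, word_singleton] at h₁
    have h₅ := h₁.trans h₂ le_rfl
    simp only [List.reverse_append, List.reverse_cons, List.reverse_replicate,
      List.append_assoc, List.singleton_append, List.reverse_reverse] at h₅ h₄
    exact h₅.trans h₄ htime
  · have hroot : T.rooting = T.subdivide T.center (T.attach_center_isTree h) := dif_neg h
    have hcount : 2 ≤ (List.finRange T.n).countP (memBit T.center) := by
      obtain h' | ⟨α, β, hαβ, h'⟩ := hcases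
      · exact absurd h' h
      rw [two_le_countP_finRange_iff]
      exact ⟨α, β, by simp [memBit, h'], by simp [memBit, h'], hαβ.ne⟩
    rw [if_pos hcount] at h₂
    have h₃ := runs_edge (List.finRange T.n) (adjBit T.graph) (memBit T.center)
    rw [← encodeGraph_eq, ← encodeGraph_attach, List.length_finRange] at h₃
    rw [hroot]
    exact (h₁.trans h₂ le_rfl).trans h₃ htime

/-- The machine computes `FinTree.rooting` in polynomial time. -/
noncomputable def rootingComputable :
    TM2ComputableInPolyTime FinTree.encode RootedFinTree.encode FinTree.rooting where
  tm := machine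
  inputAlphabet := Equiv.refl Symb
  outputAlphabet := Equiv.refl Symb
  time := 8 * (Polynomial.X + 1) ^ 3
  outputsFun T := by
    have h := runs_rooting T none
    -- The number of steps is data here, so it is extracted by choice; the halting step at `done`
    -- adds one.
    have hk := h.choose_spec.choose_spec
    refine ⟨⟨h.choose_spec.choose + 1, ?_⟩, ?_⟩
    · have hinit (w : List Symb) : initList machine w =
          (⟨some .init, none, contents w [] [] [] []⟩ : MCfg) := by
        refine congrArg (TM2.Cfg.mk _ _) (funext fun k => ?_)
        cases k <;> rfl
      have hhalt (w : List Symb) : haltList machine w =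
          (⟨none, none, contents w [] [] [] []⟩ : MCfg) := by
        refine congrArg (TM2.Cfg.mk _ _) (funext fun k => ?_)
        cases k <;> rfl
      have hmap (w : List Symb) : w.map (Equiv.refl Symb).invFun = w := List.map_id w
      have hrun : (flip bind (TM2.step program))^[h.choose_spec.choose + 1]
          (some (⟨some .init, none, contents T.encode [] [] [] []⟩ : MCfg)) =
          some ⟨none, none, contents T.rooting.encode [] [] [] []⟩ := by
        rw [Function.iterate_succ_apply', hk.2]
        rfl
      have e₁ := (congrArg (initList machine) (hmap T.encode)).trans (hinit T.encode)
      have e₂ := (congrArg (haltList machine) (hmap T.rooting.encode)).trans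
        (hhalt T.rooting.encode)
      exact (congrArg (fun c => (flip bind machine.step)^[h.choose_spec.choose + 1] (some c))
        e₁).trans (hrun.trans (congrArg some e₂).symm)
    · have hlen : T.encode.length = T.n * (T.n + 1) := by
        rw [FinTree.encode, encodeGraph_eq, length_matrixWord, List.length_finRange]
      -- The time bound must be a polynomial in the input length `n * (n + 1)`, which is at least
      -- `n`.
      have h₁ : T.n ≤ T.encode.length := by rw [hlen]; exact Nat.le_mul_of_pos_right _ (by omega)
      have h₂ : (T.n + 1) ^ 3 ≤ (T.encode.length + 1) ^ 3 := Nat.pow_le_pow_left (by omega) 3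
      have h₃ : 0 < (T.n + 1) ^ 3 := by positivity
      simp only [Polynomial.eval_mul, Polynomial.eval_ofNat, Polynomial.eval_pow,
        Polynomial.eval_add, Polynomial.eval_X, Polynomial.eval_one]
      have := hk.1
      omega

end

end TreeRooting

theorem mainTheorem8 :
    ∃ f : TreeRooting.FinTree → TreeRooting.RootedFinTree,
      Nonempty (Turing.TM2ComputableInPolyTime
        TreeRooting.FinTree.encode TreeRooting.RootedFinTree.encode f) ∧
      ∀ T : TreeRooting.FinTree,
        (∀ (G : Type*) [Group G],
          TreeRooting.Representable G T.graph ↔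
            TreeRooting.RootedRepresentable G (f T).graph (f T).root) ∧
        ∃ ι : Fin T.n ↪ Fin (f T).n,
          (TreeRooting.IsRootingAtFixedVertex T (f T) ι ∨
            TreeRooting.IsRootingAtFixedEdge T (f T) ι) ∧
          TreeRooting.SameAutomorphisms T (f T) ι := by
  refine ⟨TreeRooting.FinTree.rooting, ⟨TreeRooting.rootingComputable⟩, fun T => ?_⟩
  obtain ⟨ι, h, Φ, hΦ⟩ := T.rooting_spec
  exact ⟨fun G _ => TreeRooting.representable_iff_of_mulEquiv Φ G, ι, h, Φ, hΦ⟩
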